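/- Let $\mathcal H=(V,E)$ be a connected hypergraph, where $V$ is a finite set and $E$ is a finite multiset of non-empty subsets of $V$ (the hyperedges). Its bipartite graph $\mathrm{Bip}\,\mathcal H$ has colour classes $V$ and $E$, with $v\in V$ adjacent to $e\in E$ if and only if $v\in e$; connected means that $\mathrm{Bip}\,\mathcal H$ is connected. A hypertree is a function $f:E\to\{0,1,2,\dots\}$ for which $\mathrm{Bip}\,\mathcal H$ has a spanning tree $\tau$ with $d_\tau(e)=f(e)+1$ for all $e\in E$; let $B_{\mathcal H}$ be the set of hypertrees. For a hypertree $f$ and distinct $e,e'\in E$, we say that $e$ can transfer valence to $e'$ with respect to $f$ if the function obtained from $f$ by decreasing $f(e)$ by $1$ and increasing $f(e')$ by $1$ is again a hypertree. Given a total order $O$ on $E$, a hyperedge $e$ is internally inactive with respect to $f$ if it can transfer valence to some $e'<e$, and externally inactive with respect to $f$ if some $e'<e$ can transfer valence to $e$. Let $\overline\iota_O(f)$ and $\overline\epsilon_O(f)$ be the numbers of internally and externally inactive hyperedges, and let $$I_{\mathcal H,O}(x)=\sum_{f\in B_{\mathcal H}}x^{\overline\iota_O(f)},\qquad X_{\mathcal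 H,O}(y)=\sum_{f\in B_{\mathcal H}}y^{\overline\epsilon_O(f)}.$$ Then for any two total orders $O,O'$ on $E$, $I_{\mathcal H,O}(x)=I_{\mathcal H,O'}(x)$ and $X_{\mathcal H,O}(y)=X_{\mathcal H,O'}(y)$. -/

import Mathlib

open Polynomial

/-- A hypergraph with vertex type `V` and hyperedges labelled by `E`: a family of non-empty
subsets of `V`. Distinct labels may carry the same subset, so the hyperedges form a multiset. -/
structure MultiHypergraph (V E : Type*) where
  /-- the set of vertices of a hyperedge -/
  verts : E → Set V
  verts_nonempty : ∀ e, (verts e).Nonempty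

namespace MultiHypergraph

variable {V E : Type*}

/-- The bipartite graph of `H`, with colour classes `V` and `E`;
`v` is adjacent to `e` if and only if `v ∈ e`. -/
def bip (H : MultiHypergraph V E) : SimpleGraph (V ⊕ E) where
  Adj
    | Sum.inl v, Sum.inr e => v ∈ H.verts e
    | Sum.inr e, Sum.inl v => v ∈ H.verts e
    | _, _ => False
  symm := ⟨by rintro (a | a) (b | b) h <;> exact h⟩
  loopless := ⟨by rintro (a | a) h <;> exact h⟩

/-- A hypergraph is connected if its bipartite graph is. -/
def Connected (H : MultiHypergraph V E) : Prop := H.bip.Connected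

/-- `f` is a hypertree: some spanning tree `τ` of the bipartite graph has degree `f e + 1`
at every hyperedge `e`. -/
def IsHypertree (H : MultiHypergraph V E) (f : E → ℕ) : Prop :=
  ∃ τ : SimpleGraph (V ⊕ E), τ ≤ H.bip ∧ τ.IsTree ∧
    ∀ e : E, (τ.neighborSet (Sum.inr e)).ncard = f e + 1

/-- With respect to `f`, the hyperedge `e` can transfer valence to the hyperedge `e'`:
decreasing `f e` by 1 and increasing `f e'` by 1 gives a hypertree. -/
def CanTransfer (H : MultiHypergraph V E) (f : E → ℕ) (e e' : E) : Prop :=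
  e ≠ e' ∧ ∃ g : E → ℕ, H.IsHypertree g ∧ g e + 1 = f e ∧ g e' = f e' + 1 ∧
    ∀ d, d ≠ e → d ≠ e' → g d = f d

/-- `e` is internally active: it cannot transfer valence to any smaller hyperedge. -/
def IsInternallyActive (H : MultiHypergraph V E) (o : LinearOrder E) (f : E → ℕ) (e : E) : Prop :=
  ∀ e', o.lt e' e → ¬ H.CanTransfer f e e'

/-- `e` is externally active: no smaller hyperedge can transfer valence to it. -/
def IsExternallyActive (H : MultiHypergraph V E) (o : LinearOrder E) (f : E → ℕ) (e : E) : Prop :=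
  ∀ e', o.lt e' e → ¬ H.CanTransfer f e' e

/-- The number of internally inactive hyperedges. -/
noncomputable def internalInactivity (H : MultiHypergraph V E) (o : LinearOrder E)
    (f : E → ℕ) : ℕ :=
  {e | ¬ H.IsInternallyActive o f e}.ncard

/-- The number of externally inactive hyperedges. -/
noncomputable def externalInactivity (H : MultiHypergraph V E) (o : LinearOrder E)
    (f : E → ℕ) : ℕ :=
  {e | ¬ H.IsExternallyActive o f e}.ncard

theorem finite_setOf_isHypertree [Finite V] [Finite E] (H : MultiHypergraph V E) :
    {f | H.IsHypertree f}.Finite := by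
  refine (Set.Finite.pi' (t := fun _ : E => Set.Iic (Nat.card (V ⊕ E)))
    fun _ => Set.finite_Iic _).subset ?_
  rintro f ⟨τ, -, -, hd⟩ e
  have h := Set.ncard_le_ncard (Set.subset_univ (τ.neighborSet (Sum.inr e)))
  rw [hd e, Set.ncard_univ] at h
  exact Set.mem_Iic.2 (by omega)

/-- The finite set of all hypertrees. -/
noncomputable def hypertrees [Finite V] [Finite E] (H : MultiHypergraph V E) : Finset (E → ℕ) :=
  H.finite_setOf_isHypertree.toFinset

/-- The interior polynomial of `H` with respect to the order `o` on the hyperedges. -/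
noncomputable def interiorPolynomial [Finite V] [Finite E] (H : MultiHypergraph V E)
    (o : LinearOrder E) : ℤ[X] :=
  ∑ f ∈ H.hypertrees, X ^ H.internalInactivity o f

/-- The exterior polynomial of `H` with respect to the order `o` on the hyperedges. -/
noncomputable def exteriorPolynomial [Finite V] [Finite E] (H : MultiHypergraph V E)
    (o : LinearOrder E) : ℤ[X] :=
  ∑ f ∈ H.hypertrees, X ^ H.externalInactivity o f

end MultiHypergraph

/-!
The hypertrees of a connected hypergraph satisfy an exchange property, and for any finite family of
integer vectors with this property the inactivity statistic can be read off from numbers that do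
not mention the order.

*Order independence for exchange families.* Let `B` be a finite set of integer vectors on `E` with
constant coordinate sum such that, whenever `f a < g a` for `f, g ∈ B`, some `b` with `g b < f b`
has `f - 1_b + 1_a ∈ B` (`UpExchange`). Call `e` passive for `f` if `f - 1_e + 1_e' ∈ B` for some
`e' < e`. Every integer vector `p` below some member of `B` lies below exactly one `f ∈ B` that
agrees with `p` on the passive elements of `f`: among the members of `B` above `p`, it is the
lexicographically largest one. Hence the number of vectors lying `t` below `B` is the sum over
`f ∈ B` of the number of ways to write `t` as an ordered sum indexed by the non-passive elements of
`f`. In terms of generating functions, with `N t` the former number and `P` the passivity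
polynomial, `(∑ t, N t * x ^ t) * (1 - x) ^ |E| = P (1 - x)`. The left-hand side does not involve
the order, and `P` is recovered by substituting `1 - x` once more (`sum_X_pow_card_passiveSet_eq`).

*Exchange for hypertrees.* The edge sets of the spanning trees of the bipartite graph are the bases
of a matroid on `V × E`, and a hypertree records, up to the shift by one, how many edges of a base
carry each label `e ∈ E`. If a base `S` has more edges labelled `a` than a base `T`, remove from `S`
an edge labelled `a` outside `T` and insert an edge of `T`. If the label of the inserted edge is not
one where `S` had fewer edges than `T`, the process continues with that label; each step brings
the base closer to `T`, so it ends (`Matroid.IsBase.exists_labelCount_lower`). The dual matroid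
gives the opposite exchange (`Matroid.IsBase.exists_labelCount_raise`).

Both exchanges together say that the hypertrees and their negatives are exchange families. The
interior polynomial is the passivity polynomial of the former, the exterior polynomial that of the
latter.
-/

/-! ### Points below an exchange family -/

section Exchange

variable {E : Type*} [Fintype E] [DecidableEq E]

/-- The upward half of the exchange property of an M-convex set of integer vectors: a coordinate
of `f` that is smaller than in `g` can be raised, at the expense of one that is larger than in `g`. -/
def UpExchange (B : Finset (E → ℤ)) : Prop :=
  ∀ f ∈ B, ∀ g ∈ B, ∀ a, f a < g a → ∃ b, g b < f b ∧ f - Pi.single b 1 + Pi.single a 1 ∈ B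

/-- The elements from which a unit can be moved to a smaller element without leaving `B`. For
hypertrees these are the internally inactive hyperedges. -/
noncomputable def passiveSet (o : LinearOrder E) (B : Finset (E → ℤ)) (f : E → ℤ) : Finset E :=
  open Classical in {e | ∃ e', o.lt e' e ∧ f - Pi.single e 1 + Pi.single e' 1 ∈ B}

theorem mem_passiveSet {o : LinearOrder E} {B : Finset (E → ℤ)} {f : E → ℤ} {e : E} :
    e ∈ passiveSet o B f ↔ ∃ e', o.lt e' e ∧ f - Pi.single e 1 + Pi.single e' 1 ∈ B := by
  simp [passiveSet]

theorem exists_mem_eq_on_passiveSet (o : LinearOrder E) {B : Finset (E → ℤ)} {p f₀ : E → ℤ}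
    (hf₀ : f₀ ∈ B) (hp : p ≤ f₀) :
    ∃ f ∈ B, p ≤ f ∧ ∀ e ∈ passiveSet o B f, p e = f e := by
  classical
  -- The lexicographically largest member above `p` works: moving a unit from a passive `e` with
  -- `p e < f e` to a smaller element would stay above `p` and increase it.
  obtain ⟨f, hf, hmax⟩ := Finset.exists_max_image (B.filter (p ≤ ·)) (toLex : (E → ℤ) → _)
    ⟨f₀, by simp [hf₀, hp]⟩
  simp only [Finset.mem_filter, and_imp] at hf hmax
  refine ⟨f, hf.1, hf.2, fun e he => ?_⟩
  obtain ⟨e', hlt, hB⟩ := mem_passiveSet.1 he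
  have hne : e' ≠ e := @ne_of_lt E o.toPreorder _ _ hlt
  by_contra hpe
  have hpe : p e < f e := lt_of_le_of_ne (hf.2 e) hpe
  refine (hmax _ hB fun d => ?_).not_gt ⟨e', fun d hd => ?_, ?_⟩
  · have hd : p d ≤ f d := hf.2 d
    by_cases h : d = e
    · subst h; simp [hne.symm]; omega
    · by_cases h' : d = e'
      · subst h'; simp [hne]; omega
      · simpa [h, h'] using hd
  · have h1 : d ≠ e' := @ne_of_lt E o.toPreorder _ _ hd
    have h2 : d ≠ e := @ne_of_lt E o.toPreorder _ _ (@lt_trans E o.toPreorder _ _ _ hd hlt)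
    simp [h1, h2]
  · simp [hne]

theorem eq_of_eq_on_passiveSet (o : LinearOrder E) {B : Finset (E → ℤ)} (hB : UpExchange B)
    {p f g : E → ℤ} (hf : f ∈ B) (hpf : p ≤ f) (hf' : ∀ e ∈ passiveSet o B f, p e = f e)
    (hg : g ∈ B) (hpg : p ≤ g) (hg' : ∀ e ∈ passiveSet o B g, p e = g e) : f = g := by
  by_contra hne
  have hD : (Finset.univ.filter fun e => f e ≠ g e).Nonempty := by
    obtain ⟨e, he⟩ := Function.ne_iff.1 hne
    exact ⟨e, by simpa using he⟩
  -- At the first difference `a`, say `f a < g a`, an exchange raises `f a` at the expense of some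
  -- `b > a` with `p b ≤ g b < f b`, which makes `b` passive for `f` although `p b ≠ f b`.
  obtain ⟨a, ha, hmin⟩ := Finset.exists_min_image _ (id : E → E) hD
  simp only [Finset.mem_filter_univ, id] at ha hmin
  wlog h : f a < g a generalizing f g
  · exact this hg hpg hg' hf hpf hf' (Ne.symm hne) (by simpa [ne_comm] using hD) ha.symm
      (fun e he => hmin e he.symm) (lt_of_le_of_ne (not_lt.1 h) ha.symm)
  obtain ⟨b, hb, hbB⟩ := hB f hf g hg a h
  have hab : a ≠ b := by rintro rfl; omega
  have := hf' b (mem_passiveSet.2 ⟨a, lt_of_le_of_ne (hmin b (by omega)) hab, hbB⟩)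
  have : p b ≤ g b := hpg b
  omega

theorem card_finsuppAntidiag_eq_coeff {E : Type*} [DecidableEq E] (s : Finset E) (t : ℕ) :
    ((s.finsuppAntidiag t).card : ℤ) =
      PowerSeries.coeff t ((PowerSeries.mk 1 : PowerSeries ℤ) ^ s.card) := by
  rw [← Finset.prod_const, PowerSeries.coeff_prod]
  simp

/-- The vectors obtained from some member of `B` by lowering coordinates by `t` in total. When `B`
has constant coordinate sum, they are the vectors below `B` whose sum is smaller by `t`. -/
noncomputable def lowerPoints (B : Finset (E → ℤ)) (t : ℕ) : Finset (E → ℤ) :=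
  (B ×ˢ (Finset.univ : Finset E).finsuppAntidiag t).image fun x e => x.1 e - x.2 e

/-- Each vector below `B` is `f - c` for a unique `f ∈ B` and a unique `c` supported off the
passive elements of `f`. -/
theorem sum_card_finsuppAntidiag_eq_card_lowerPoints (o : LinearOrder E) {B : Finset (E → ℤ)}
    (hB : UpExchange B) (hsum : ∀ f ∈ B, ∀ g ∈ B, ∑ e, f e = ∑ e, g e) (t : ℕ) :
    ∑ f ∈ B, ((passiveSet o B f)ᶜ.finsuppAntidiag t).card = (lowerPoints B t).card := by
  rw [← Finset.card_sigma]
  refine Finset.card_bij (fun x _ e => x.1 e - x.2 e) ?_ ?_ ?_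
  · rintro ⟨f, c⟩ h
    simp only [Finset.mem_sigma, Finset.mem_finsuppAntidiag] at h
    refine Finset.mem_image.2 ⟨(f, c), ?_, rfl⟩
    simp only [Finset.mem_product, Finset.mem_finsuppAntidiag, Finset.subset_univ, and_true]
    refine ⟨h.1, ?_⟩
    rw [← h.2.1]
    refine (Finset.sum_subset (Finset.subset_univ _) fun e _ he => ?_).symm
    by_contra h0
    exact he (h.2.2 (Finsupp.mem_support_iff.2 h0))
  · rintro ⟨f, c⟩ h ⟨g, d⟩ h' heq
    simp only [Finset.mem_sigma, Finset.mem_finsuppAntidiag] at h h'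
    have key : ∀ {f : E → ℤ} {c : E →₀ ℕ}, c.support ⊆ (passiveSet o B f)ᶜ →
        (∀ e ∈ passiveSet o B f, f e - c e = f e) := by
      intro f c hc e he
      have : c e = 0 := by
        by_contra h0
        exact Finset.mem_compl.1 (hc (Finsupp.mem_support_iff.2 h0)) he
      simp [this]
    have hfg : f = g := eq_of_eq_on_passiveSet o hB (p := fun e => f e - c e) h.1
      (fun e => by simp) (key h.2.2) h'.1 (fun e => by have := congrFun heq e; simp at this ⊢; omega)
      (fun e he => (congrFun heq e).trans (key h'.2.2 e he))
    subst hfg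
    have : c = d := by
      ext e
      have := congrFun heq e
      simp at this
      exact this
    rw [this]
  · intro p hp
    obtain ⟨⟨f₀, c₀⟩, h₀, rfl⟩ := Finset.mem_image.1 hp
    simp only [Finset.mem_product, Finset.mem_finsuppAntidiag, Finset.subset_univ, and_true] at h₀
    obtain ⟨f, hf, hle, heq⟩ := exists_mem_eq_on_passiveSet o (p := fun e => f₀ e - c₀ e) h₀.1
      (fun e => by simp)
    set c : E →₀ ℕ := Finsupp.equivFunOnFinite.symm fun e => (f e - (f₀ e - c₀ e)).toNat with hc
    have hce : ∀ e, (c e : ℤ) = f e - (f₀ e - c₀ e) := fun e => by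
      have := hle e
      simp [hc] at this ⊢
      omega
    have hsupp : c.support ⊆ (passiveSet o B f)ᶜ := by
      intro e he
      rw [Finset.mem_compl]
      intro he'
      have h1 := heq e he'
      have h2 := hce e
      exact Finsupp.mem_support_iff.1 he (by omega)
    refine ⟨⟨f, c⟩, ?_, ?_⟩
    · simp only [Finset.mem_sigma, Finset.mem_finsuppAntidiag]
      refine ⟨hf, ?_, hsupp⟩
      rw [Finset.sum_subset (Finset.subset_univ _) fun e _ he => ?_]
      · have h1 : ∑ e, (c e : ℤ) = ∑ e, (c₀ e : ℤ) := by
          simp only [hce, Finset.sum_sub_distrib, hsum f hf f₀ h₀.1]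
          ring
        rw [← h₀.2]
        exact_mod_cast h1
      · by_contra h0
        exact he (hsupp (Finsupp.mem_support_iff.2 h0))
    · funext e
      simp [hce]

/-- The passivity polynomial at `1 - x`, expressed through the numbers of points below `B`, which
do not depend on the order. -/
theorem mk_card_lowerPoints_mul (o : LinearOrder E) {B : Finset (E → ℤ)}
    (hB : UpExchange B) (hsum : ∀ f ∈ B, ∀ g ∈ B, ∑ e, f e = ∑ e, g e) :
    (PowerSeries.mk fun t => ((lowerPoints B t).card : ℤ)) *
        (1 - PowerSeries.X) ^ Fintype.card E =
      (((∑ f ∈ B, X ^ (passiveSet o B f).card : ℤ[X]).comp (1 - X) : ℤ[X]) : PowerSeries ℤ) := by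
  have h1 : (PowerSeries.mk fun t => ((lowerPoints B t).card : ℤ)) =
      ∑ f ∈ B, (PowerSeries.mk 1 : PowerSeries ℤ) ^ (passiveSet o B f)ᶜ.card := by
    ext t
    rw [PowerSeries.coeff_mk, ← sum_card_finsuppAntidiag_eq_card_lowerPoints o hB hsum]
    simp [card_finsuppAntidiag_eq_coeff]
  have h2 : (((∑ f ∈ B, X ^ (passiveSet o B f).card : ℤ[X]).comp (1 - X) : ℤ[X]) :
      PowerSeries ℤ) = ∑ f ∈ B, (1 - PowerSeries.X) ^ (passiveSet o B f).card := by
    rw [← Polynomial.coeToPowerSeries.ringHom_apply]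
    simp [Polynomial.sum_comp]
  rw [h1, h2, Finset.sum_mul]
  refine Finset.sum_congr rfl fun f _ => ?_
  rw [← Finset.card_compl_add_card (passiveSet o B f), pow_add, ← mul_assoc, ← mul_pow,
    PowerSeries.mk_one_mul_one_sub_eq_one, one_pow, one_mul]

theorem sum_X_pow_card_passiveSet_eq (o₁ o₂ : LinearOrder E) {B : Finset (E → ℤ)}
    (hB : UpExchange B) (hsum : ∀ f ∈ B, ∀ g ∈ B, ∑ e, f e = ∑ e, g e) :
    (∑ f ∈ B, X ^ (passiveSet o₁ B f).card : ℤ[X]) = ∑ f ∈ B, X ^ (passiveSet o₂ B f).card := by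
  have h := (mk_card_lowerPoints_mul o₁ hB hsum).symm.trans (mk_card_lowerPoints_mul o₂ hB hsum)
  -- Substituting `1 - X` for `X` is an involution.
  have h := congrArg (fun q : ℤ[X] => q.comp (1 - X)) (Polynomial.coe_injective ℤ h)
  simpa [Polynomial.comp_assoc] using h

end Exchange

/-! ### Label counts of matroid bases -/

section LabelCount

variable {α E : Type*} [Finite α]

/-- The number of elements of `S` with label `e`, as an integer so that counts can be subtracted. -/
noncomputable def labelCount (φ : α → E) (S : Set α) (e : E) : ℤ := {x ∈ S | φ x = e}.ncard

theorem labelCount_insert [DecidableEq E] (φ : α → E) {S : Set α} {x : α} (hx : x ∉ S) :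
    labelCount φ (insert x S) = labelCount φ S + Pi.single (φ x) 1 := by
  funext e
  by_cases h : φ x = e
  · have : {z ∈ insert x S | φ z = e} = insert x {z ∈ S | φ z = e} := by
      ext z; simp only [Set.mem_insert_iff, Set.mem_ofPred_eq]; grind
    subst h
    simp only [labelCount, Pi.add_apply, Pi.single_eq_same, this]
    rw [Set.ncard_insert_of_notMem fun h => hx h.1]
    push_cast
    rfl
  · have : {z ∈ insert x S | φ z = e} = {z ∈ S | φ z = e} := by
      ext z; simp only [Set.mem_insert_iff, Set.mem_ofPred_eq]; grind
    simp only [labelCount, Pi.add_apply, Pi.single_eq_of_ne' h, this, add_zero]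

theorem labelCount_exchange [DecidableEq E] (φ : α → E) {S : Set α} {x y : α}
    (hx : x ∈ S) (hy : y ∉ S) :
    labelCount φ (insert y (S \ {x})) =
      labelCount φ S - Pi.single (φ x) 1 + Pi.single (φ y) 1 := by
  have h := labelCount_insert φ (S := S \ {x}) (x := x) (by simp)
  rw [Set.insert_sdiff_singleton, Set.insert_eq_of_mem hx] at h
  rw [labelCount_insert φ (by simp [hy]), h, add_sub_cancel_right]

theorem labelCount_sdiff (φ : α → E) {S U : Set α} (h : S ⊆ U) :
    labelCount φ (U \ S) = labelCount φ U - labelCount φ S := by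
  funext e
  have : {z ∈ U \ S | φ z = e} = {z ∈ U | φ z = e} \ {z ∈ S | φ z = e} := by
    ext z; simp only [Set.mem_ofPred_eq, Set.mem_sdiff]; grind
  have hsub : {z ∈ S | φ z = e} ⊆ {z ∈ U | φ z = e} := fun z hz => ⟨h hz.1, hz.2⟩
  have := Set.ncard_sdiff_add_ncard_of_subset hsub
  simp only [labelCount, Pi.sub_apply, *]
  omega

theorem sum_labelCount [Fintype E] [DecidableEq E] (φ : α → E) (S : Set α) :
    ∑ e, labelCount φ S e = S.ncard := by
  induction S, Set.toFinite S using Set.Finite.induction_on with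
  | empty => simp [labelCount]
  | insert ha _ ih =>
    rw [labelCount_insert φ ha, Set.ncard_insert_of_notMem ha]
    simp [Finset.sum_add_distrib, ih]

/-- The vectors of label counts of bases allow lowering a coordinate of `S` that exceeds the one
of `T`, in favour of a coordinate that is smaller than in `T`. -/
theorem Matroid.IsBase.exists_labelCount_lower [DecidableEq E] {M : Matroid α} (φ : α → E)
    {S T : Set α} (hS : M.IsBase S) (hT : M.IsBase T) {a : E} (ha : labelCount φ T a < labelCount φ S a) :
    ∃ b, labelCount φ S b < labelCount φ T b ∧ ∃ S', M.IsBase S' ∧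
      labelCount φ S' = labelCount φ S - Pi.single a 1 + Pi.single b 1 := by
  generalize hf : labelCount φ S = f at *
  -- `R` is a base closer to `T` whose surplus unit currently sits at a label `d` that cannot serve
  -- as `b`. The initial position is `d = a` and `R = S`.
  have key : ∀ n, ∀ R, M.IsBase R → (R \ T).ncard = n → ∀ d, labelCount φ T d ≤ f d →
      labelCount φ R = f - Pi.single a 1 + Pi.single d 1 →
      ∃ b, f b < labelCount φ T b ∧ ∃ S', M.IsBase S' ∧
        labelCount φ S' = f - Pi.single a 1 + Pi.single b 1 := by
    intro n
    induction n using Nat.strong_induction_on with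
    | _ n ih =>
    intro R hR hn d hd hRd
    have hlt : labelCount φ T d < labelCount φ R d := by
      rw [hRd]
      by_cases h : d = a
      · subst h; simpa using ha
      · simp [h]; omega
    obtain ⟨x, ⟨hxR, hxd⟩, hxT⟩ : ∃ x ∈ {x ∈ R | φ x = d}, x ∉ {x ∈ T | φ x = d} := by
      by_contra! hcon
      have := Set.ncard_le_ncard (show {x ∈ R | φ x = d} ⊆ {x ∈ T | φ x = d} from hcon)
      simp only [labelCount] at hlt
      omega
    replace hxT : x ∉ T := fun h => hxT ⟨h, hxd⟩
    obtain ⟨y, hy, hbase⟩ := hR.exchange hT ⟨hxR, hxT⟩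
    have hcount : labelCount φ (insert y (R \ {x})) = f - Pi.single a 1 + Pi.single (φ y) 1 := by
      rw [labelCount_exchange φ hxR hy.2, hRd, hxd, add_sub_cancel_right]
    rcases lt_or_ge (f (φ y)) (labelCount φ T (φ y)) with h | h
    · exact ⟨φ y, h, _, hbase, hcount⟩
    · refine ih _ ?_ _ hbase rfl (φ y) h hcount
      rw [← hn]
      refine Set.ncard_lt_ncard ⟨?_, fun h => ?_⟩
      · rintro z ⟨rfl | hz, hzT⟩
        · exact absurd hy.1 hzT
        · exact ⟨hz.1, hzT⟩
      · rcases (h ⟨hxR, hxT⟩).1 with h | h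
        · exact hy.2 (h ▸ hxR)
        · exact h.2 rfl
  exact key _ S hS rfl a ha.le (by rw [hf]; simp)

/-- The exchange opposite to `Matroid.IsBase.exists_labelCount_lower`, which is the same statement
for the dual matroid, since complementing bases reverses the order of label counts. -/
theorem Matroid.IsBase.exists_labelCount_raise [DecidableEq E] {M : Matroid α} (φ : α → E)
    {S T : Set α} (hS : M.IsBase S) (hT : M.IsBase T) {a : E} (ha : labelCount φ S a < labelCount φ T a) :
    ∃ b, labelCount φ T b < labelCount φ S b ∧ ∃ S', M.IsBase S' ∧
      labelCount φ S' = labelCount φ S - Pi.single b 1 + Pi.single a 1 := by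
  have hcS := labelCount_sdiff φ hS.subset_ground
  have hcT := labelCount_sdiff φ hT.subset_ground
  obtain ⟨b, hb, S', hS', hcount⟩ := hS.compl_isBase_dual.exists_labelCount_lower φ
    hT.compl_isBase_dual (a := a) (by simp only [hcS, hcT, Pi.sub_apply]; omega)
  simp only [hcS, hcT, Pi.sub_apply] at hb
  refine ⟨b, by omega, M.E \ S', hS'.compl_isBase_of_dual, ?_⟩
  rw [labelCount_sdiff φ (show S' ⊆ M.E from hS'.subset_ground), hcount, hcS]
  abel

end LabelCount

/-! ### Spanning trees of the bipartite graph -/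

namespace SimpleGraph

/-- Deleting an edge `uv` of a tree leaves two components, and a connected graph `T'` on the same
vertices has an edge `xy` between them; if `uv` is not in `T'`, this edge is not in the tree. -/
theorem IsTree.exists_exchange {W : Type*} {T T' : SimpleGraph W} (hT : T.IsTree)
    (hT' : T'.Connected) {u v : W} (huv : T.Adj u v) (huv' : ¬ T'.Adj u v) :
    ∃ x y, T'.Adj x y ∧ ¬ T.Adj x y ∧ (T.deleteEdges {s(u, v)} ⊔ edge x y).IsTree := by
  set D := T.deleteEdges {s(u, v)} with hD
  have hDT : D ≤ T := T.deleteEdges_le _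
  have hbr : ¬ D.Reachable u v := by
    rw [← isBridge_iff]
    exact isAcyclic_iff_forall_isBridge.1 hT.isAcyclic huv
  have hcover : ∀ w, D.Reachable u w ∨ D.Reachable v w := by
    intro w
    by_contra hw
    obtain ⟨p⟩ := hT.connected u w
    obtain ⟨⟨⟨a, b⟩, hab⟩, -, ha, hb⟩ :=
      p.exists_boundary_dart {w | D.Reachable u w ∨ D.Reachable v w} (Or.inl .rfl) hw
    simp only [Set.mem_ofPred_eq] at ha hb
    by_cases h : s(a, b) = s(u, v)
    · rcases Sym2.eq_iff.1 h with ⟨rfl, rfl⟩ | ⟨rfl, rfl⟩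
      · exact hb (Or.inr .rfl)
      · exact hb (Or.inl .rfl)
    · have hadj : D.Adj a b := by simp [hD, deleteEdges_adj, h]; exact hab
      exact hb (ha.imp (·.trans hadj.reachable) (·.trans hadj.reachable))
  obtain ⟨p⟩ := hT' u v
  -- An edge of `T'` that leaves the component of `u`.
  obtain ⟨⟨⟨x, y⟩, hxy⟩, -, hx, hy⟩ := p.exists_boundary_dart {w | D.Reachable u w} .rfl hbr
  simp only [Set.mem_ofPred_eq] at hx hy hxy
  refine ⟨x, y, hxy, fun hadj => ?_, ?_, ?_⟩
  · by_cases h : s(x, y) = s(u, v)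
    · exact huv' (by rw [← mem_edgeSet, ← h]; exact hxy)
    · have hadj : D.Adj x y := by simp [hD, deleteEdges_adj, h, hadj]
      exact hy (hx.trans hadj.reachable)
  · have hle : D ≤ D ⊔ edge x y := le_sup_left
    have hux := hx.mono hle
    have hxy' : (D ⊔ edge x y).Adj x y := by simp [edge_adj, hxy.ne]
    have huv := (hux.trans hxy'.reachable).trans (((hcover y).resolve_left hy).mono hle).symm
    have hall : ∀ w, (D ⊔ edge x y).Reachable u w := fun w =>
      (hcover w).elim (·.mono hle) fun h => huv.trans (h.mono hle)
    exact (connected_iff _).2 ⟨fun a b => (hall a).symm.trans (hall b), ⟨u⟩⟩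
  · exact (hT.isAcyclic.anti hDT).sup_edge_of_not_reachable fun h => hy (hx.trans h)

end SimpleGraph

namespace MultiHypergraph

variable {V E : Type*}

/-- The bipartite graph on `V ⊕ E` whose edges are the pairs in `S`. Subgraphs of `H.bip` are
encoded by sets of pairs, so that the label of an edge is its second component. -/
def incidenceGraph (S : Set (V × E)) : SimpleGraph (V ⊕ E) where
  Adj
    | Sum.inl v, Sum.inr e => (v, e) ∈ S
    | Sum.inr e, Sum.inl v => (v, e) ∈ S
    | _, _ => False
  symm := ⟨by rintro (a | a) (b | b) h <;> exact h⟩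
  loopless := ⟨by rintro (a | a) h <;> exact h⟩

theorem incidenceGraph_exchange (S : Set (V × E)) (x y : V × E) :
    incidenceGraph (insert y (S \ {x})) =
      (incidenceGraph S).deleteEdges {s(Sum.inl x.1, Sum.inr x.2)} ⊔
        SimpleGraph.edge (Sum.inl y.1) (Sum.inr y.2) := by
  obtain ⟨x1, x2⟩ := x
  obtain ⟨y1, y2⟩ := y
  ext (a | a) (b | b) <;>
    simp [incidenceGraph, SimpleGraph.edge_adj, SimpleGraph.deleteEdges_adj] <;> tauto

theorem exchangeProperty_isTree_incidenceGraph (U : Set (V × E)) :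
    Matroid.ExchangeProperty fun S : Set (V × E) => S ⊆ U ∧ (incidenceGraph S).IsTree := by
  rintro S T ⟨hSU, hS⟩ ⟨hTU, hT⟩ ⟨v, e⟩ ⟨hxS, hxT⟩
  obtain ⟨a, b, h1, h2, h3⟩ := hS.exists_exchange hT.connected (u := Sum.inl v) (v := Sum.inr e)
    hxS hxT
  obtain ⟨y, hyT, hyS, hy⟩ : ∃ y : V × E, y ∈ T ∧ y ∉ S ∧
      (incidenceGraph (insert y (S \ {(v, e)}))).IsTree := by
    rcases a with a | a <;> rcases b with b | b
    · exact h1.elim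
    · exact ⟨(a, b), h1, h2, by rwa [incidenceGraph_exchange]⟩
    · exact ⟨(b, a), h1, h2, by rwa [incidenceGraph_exchange, SimpleGraph.edge_comm]⟩
    · exact h1.elim
  exact ⟨y, ⟨hyT, hyS⟩, Set.insert_subset (hTU hyT) (Set.sdiff_subset.trans hSU), hy⟩

theorem labelCount_snd (S : Set (V × E)) (e : E) :
    labelCount Prod.snd S e = ((incidenceGraph S).neighborSet (Sum.inr e)).ncard := by
  have h1 : (incidenceGraph S).neighborSet (Sum.inr e) = Sum.inl '' {v | (v, e) ∈ S} := by
    ext (a | a) <;> simp [incidenceGraph]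
  have h2 : {x ∈ S | x.2 = e} = (·, e) '' {v | (v, e) ∈ S} := by
    ext ⟨a, b⟩
    simp only [Set.mem_ofPred_eq, Set.mem_image, Prod.mk.injEq]
    grind
  rw [labelCount, h1, h2, Set.ncard_image_of_injective _ Sum.inl_injective,
    Set.ncard_image_of_injective _ fun a b h => (Prod.mk.inj h).1]

/-- The vertex-hyperedge incidences of `H`, that is, the edges of `H.bip` as pairs. -/
def incidences (H : MultiHypergraph V E) : Set (V × E) := {x | x.1 ∈ H.verts x.2}

theorem incidenceGraph_setOf_adj (H : MultiHypergraph V E) {τ : SimpleGraph (V ⊕ E)}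
    (hle : τ ≤ H.bip) :
    incidenceGraph {x : V × E | τ.Adj (Sum.inl x.1) (Sum.inr x.2)} = τ := by
  ext (a | a) (b | b)
  · exact iff_of_false id fun h => (hle h : False)
  · exact Iff.rfl
  · exact τ.adj_comm _ _
  · exact iff_of_false id fun h => (hle h : False)

theorem setOf_adj_subset_incidences (H : MultiHypergraph V E) {τ : SimpleGraph (V ⊕ E)}
    (hle : τ ≤ H.bip) :
    {x : V × E | τ.Adj (Sum.inl x.1) (Sum.inr x.2)} ⊆ H.incidences :=
  fun x (hx : τ.Adj (Sum.inl x.1) (Sum.inr x.2)) => hle hx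

theorem isHypertree_iff_exists_labelCount (H : MultiHypergraph V E) (f : E → ℕ) :
    H.IsHypertree f ↔ ∃ S, (S ⊆ H.incidences ∧ (incidenceGraph S).IsTree) ∧
      ∀ e, labelCount Prod.snd S e = f e + 1 := by
  constructor
  · rintro ⟨τ, hle, hτ, hdeg⟩
    have heq := H.incidenceGraph_setOf_adj hle
    refine ⟨_, ⟨H.setOf_adj_subset_incidences hle, heq.symm ▸ hτ⟩, fun e => ?_⟩
    rw [labelCount_snd, heq, hdeg]
    push_cast; rfl
  · rintro ⟨S, ⟨hS, hT⟩, hcount⟩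
    refine ⟨_, ?_, hT, fun e => ?_⟩
    · rintro (a | a) (b | b) h
      · exact h.elim
      · exact hS h
      · exact hS h
      · exact h.elim
    · have := hcount e
      rw [labelCount_snd] at this
      exact_mod_cast this

/-- The graphic matroid of `H.bip`. Connectedness provides a spanning tree, hence a base. -/
theorem exists_matroid_isHypertree_iff [Finite V] [Finite E] (H : MultiHypergraph V E)
    (hH : H.Connected) : ∃ M : Matroid (V × E), ∀ f : E → ℕ,
      H.IsHypertree f ↔ ∃ S, M.IsBase S ∧ ∀ e, labelCount Prod.snd S e = f e + 1 := by
  refine ⟨Matroid.ofIsBaseOfFinite (E := H.incidences) (Set.toFinite _)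
    (fun S => S ⊆ H.incidences ∧ (incidenceGraph S).IsTree) ?_
    (exchangeProperty_isTree_incidenceGraph _) fun _ h => h.1, fun f => ?_⟩
  · obtain ⟨τ, hle, hτ⟩ := SimpleGraph.Connected.exists_isTree_le hH
    have heq := H.incidenceGraph_setOf_adj hle
    exact ⟨_, H.setOf_adj_subset_incidences hle, heq.symm ▸ hτ⟩
  · exact H.isHypertree_iff_exists_labelCount f

end MultiHypergraph

/-! ### Exchange for hypertrees and the two polynomials -/

namespace MultiHypergraph

variable {V E : Type*}

/-- Transferring valence, written as addition of integer vectors. -/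
theorem canTransfer_iff [DecidableEq E] (H : MultiHypergraph V E) {f : E → ℕ} {e e' : E}
    (hne : e ≠ e') :
    H.CanTransfer f e e' ↔ ∃ g, H.IsHypertree g ∧
      (fun d => (g d : ℤ)) = (fun d => (f d : ℤ)) - Pi.single e 1 + Pi.single e' 1 := by
  refine ⟨fun ⟨_, g, hg, h1, h2, h3⟩ => ⟨g, hg, ?_⟩, fun ⟨g, hg, h⟩ => ⟨hne, g, hg, ?_, ?_, ?_⟩⟩
  · funext d
    by_cases hd : d = e
    · subst hd; simp [hne]; omega
    · by_cases hd' : d = e'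
      · subst hd'; simp [hd]; omega
      · simp [hd, hd', h3 d hd hd']
  · have := congrFun h e
    simp [hne] at this
    omega
  · have := congrFun h e'
    simp [hne.symm] at this
    omega
  · intro d hd hd'
    have := congrFun h d
    simpa [hd, hd'] using this

section Finite

variable [Finite V] [Finite E]

theorem mem_hypertrees {H : MultiHypergraph V E} {f : E → ℕ} :
    f ∈ H.hypertrees ↔ H.IsHypertree f := by
  simp [hypertrees]

/-- Both exchange properties of hypertrees: `f` can be raised at `a`, and `g` lowered at `a`, with
the compensating change at a hyperedge `b` where `g b < f b`. -/
theorem exists_isHypertree_exchange [DecidableEq E] (H : MultiHypergraph V E) (hH : H.Connected)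
    {f g : E → ℕ} (hf : H.IsHypertree f) (hg : H.IsHypertree g) {a : E} (ha : f a < g a) :
    (∃ b, g b < f b ∧ ∃ h, H.IsHypertree h ∧
      (fun d => (h d : ℤ)) = (fun d => (f d : ℤ)) - Pi.single b 1 + Pi.single a 1) ∧
    ∃ b, g b < f b ∧ ∃ h, H.IsHypertree h ∧
      (fun d => (h d : ℤ)) = (fun d => (g d : ℤ)) - Pi.single a 1 + Pi.single b 1 := by
  obtain ⟨M, hM⟩ := H.exists_matroid_isHypertree_iff hH
  obtain ⟨S, hS, hSf⟩ := (hM f).1 hf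
  obtain ⟨T, hT, hTg⟩ := (hM g).1 hg
  have hST : labelCount Prod.snd S a < labelCount Prod.snd T a := by rw [hSf, hTg]; omega
  -- A base with the right label counts yields a hypertree; the only coordinate that is lowered is
  -- positive, so no entry becomes negative.
  have lift : ∀ (R : Set (V × E)), M.IsBase R → ∀ (k : E → ℕ) (b c : E), 0 < k b →
      (∀ e, labelCount Prod.snd R e =
        ((k e : ℤ) + 1) - (Pi.single b 1 : E → ℤ) e + (Pi.single c 1 : E → ℤ) e) →
      ∃ h, H.IsHypertree h ∧
        (fun d => (h d : ℤ)) = (fun d => (k d : ℤ)) - Pi.single b 1 + Pi.single c 1 := by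
    intro R hR k b c hb hcount
    have hnn : ∀ d, 0 ≤ (k d : ℤ) - (Pi.single b 1 : E → ℤ) d + (Pi.single c 1 : E → ℤ) d := by
      intro d
      have hc : (0 : E → ℤ) ≤ Pi.single c 1 := Pi.single_nonneg.2 zero_le_one
      refine add_nonneg (sub_nonneg.2 ?_) (hc d)
      by_cases hd : d = b
      · subst hd; simp; omega
      · simp [hd]
    have hcast := fun d => Int.toNat_of_nonneg (hnn d)
    refine ⟨_, (hM _).2 ⟨R, hR, fun e => ?_⟩, funext hcast⟩
    rw [hcast, hcount]
    ring
  constructor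
  · obtain ⟨b, hb, R, hR, hcount⟩ := hS.exists_labelCount_raise Prod.snd hT hST
    rw [hSf, hTg] at hb
    exact ⟨b, by omega, lift R hR f b a (by omega) fun e => by simp [hcount, hSf]⟩
  · obtain ⟨b, hb, R, hR, hcount⟩ := hT.exists_labelCount_lower Prod.snd hS hST
    rw [hSf, hTg] at hb
    exact ⟨b, by omega, lift R hR g a b (by omega) fun e => by simp [hcount, hTg]⟩

theorem sum_eq_of_isHypertree [Fintype E] (H : MultiHypergraph V E) (hH : H.Connected)
    {f g : E → ℕ} (hf : H.IsHypertree f) (hg : H.IsHypertree g) : ∑ e, f e = ∑ e, g e := by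
  classical
  obtain ⟨M, hM⟩ := H.exists_matroid_isHypertree_iff hH
  obtain ⟨S, hS, hSf⟩ := (hM f).1 hf
  obtain ⟨T, hT, hTg⟩ := (hM g).1 hg
  have hcard := hS.ncard_eq_ncard_of_isBase hT
  have h1 := sum_labelCount Prod.snd S
  have h2 := sum_labelCount Prod.snd T
  simp only [hSf, hTg, Finset.sum_add_distrib, hcard] at h1 h2
  exact_mod_cast add_right_cancel (h1.trans h2.symm)

/-- The hypertrees as integer vectors. -/
noncomputable def intHypertrees (H : MultiHypergraph V E) : Finset (E → ℤ) :=
  H.hypertrees.map ⟨fun f e => (f e : ℤ), fun _ _ h =>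
    funext fun e => Int.ofNat_injective (congrFun h e)⟩

/-- The negatives of the hypertrees. Negation reverses transfers of valence, so it turns external
into internal inactivity. -/
noncomputable def negHypertrees (H : MultiHypergraph V E) : Finset (E → ℤ) :=
  H.hypertrees.map ⟨fun f e => -(f e : ℤ), fun _ _ h =>
    funext fun e => Int.ofNat_injective (neg_injective (congrFun h e))⟩

theorem sum_intHypertrees (H : MultiHypergraph V E) (F : (E → ℤ) → ℤ[X]) :
    ∑ p ∈ H.intHypertrees, F p = ∑ f ∈ H.hypertrees, F fun e => (f e : ℤ) :=
  Finset.sum_map ..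

theorem mem_intHypertrees {H : MultiHypergraph V E} {p : E → ℤ} :
    p ∈ H.intHypertrees ↔ ∃ f, H.IsHypertree f ∧ (fun e => (f e : ℤ)) = p := by
  simp only [intHypertrees, Finset.mem_map, mem_hypertrees]
  rfl

theorem sum_negHypertrees (H : MultiHypergraph V E) (F : (E → ℤ) → ℤ[X]) :
    ∑ p ∈ H.negHypertrees, F p = ∑ f ∈ H.hypertrees, F fun e => -(f e : ℤ) :=
  Finset.sum_map ..

theorem mem_negHypertrees {H : MultiHypergraph V E} {p : E → ℤ} :
    p ∈ H.negHypertrees ↔ ∃ f, H.IsHypertree f ∧ (fun e => -(f e : ℤ)) = p := by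
  simp only [negHypertrees, Finset.mem_map, mem_hypertrees]
  rfl

theorem upExchange_intHypertrees [DecidableEq E] (H : MultiHypergraph V E) (hH : H.Connected) :
    UpExchange H.intHypertrees := by
  intro p hp q hq a ha
  obtain ⟨f, hf, rfl⟩ := mem_intHypertrees.1 hp
  obtain ⟨g, hg, rfl⟩ := mem_intHypertrees.1 hq
  obtain ⟨b, hb, h⟩ := (H.exists_isHypertree_exchange hH hf hg (a := a) (by simpa using ha)).1
  exact ⟨b, by simpa using hb, mem_intHypertrees.2 h⟩

theorem upExchange_negHypertrees [DecidableEq E] (H : MultiHypergraph V E) (hH : H.Connected) :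
    UpExchange H.negHypertrees := by
  intro p hp q hq a ha
  obtain ⟨f, hf, rfl⟩ := mem_negHypertrees.1 hp
  obtain ⟨g, hg, rfl⟩ := mem_negHypertrees.1 hq
  obtain ⟨b, hb, h, hh, heq⟩ :=
    (H.exists_isHypertree_exchange hH hg hf (a := a) (by simpa using ha)).2
  refine ⟨b, by simpa using hb, mem_negHypertrees.2 ⟨h, hh, ?_⟩⟩
  have := congrArg Neg.neg heq
  refine this.trans ?_
  funext d
  simp
  ring

theorem interiorPolynomial_eq [Fintype E] [DecidableEq E] (H : MultiHypergraph V E)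
    (o : LinearOrder E) : H.interiorPolynomial o =
      ∑ p ∈ H.intHypertrees, X ^ (passiveSet o H.intHypertrees p).card := by
  rw [interiorPolynomial, sum_intHypertrees]
  refine Finset.sum_congr rfl fun f _ => ?_
  rw [internalInactivity, ← Set.ncard_coe_finset]
  congr 2
  ext e
  simp only [IsInternallyActive, Set.mem_ofPred_eq, Finset.mem_coe, mem_passiveSet, not_forall,
    not_not, exists_prop, mem_intHypertrees]
  refine exists_congr fun e' => and_congr_right fun hlt => ?_
  exact H.canTransfer_iff (@ne_of_gt E o.toPreorder _ _ hlt)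

theorem exteriorPolynomial_eq [Fintype E] [DecidableEq E] (H : MultiHypergraph V E)
    (o : LinearOrder E) : H.exteriorPolynomial o =
      ∑ p ∈ H.negHypertrees, X ^ (passiveSet o H.negHypertrees p).card := by
  rw [exteriorPolynomial, sum_negHypertrees]
  refine Finset.sum_congr rfl fun f _ => ?_
  rw [externalInactivity, ← Set.ncard_coe_finset]
  congr 2
  ext e
  simp only [IsExternallyActive, Set.mem_ofPred_eq, Finset.mem_coe, mem_passiveSet, not_forall,
    not_not, exists_prop, mem_negHypertrees]
  refine exists_congr fun e' => and_congr_right fun hlt => ?_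
  rw [H.canTransfer_iff (@ne_of_lt E o.toPreorder _ _ hlt)]
  refine exists_congr fun g => and_congr_right fun _ => ?_
  simp only [funext_iff, Pi.add_apply, Pi.sub_apply]
  refine forall_congr' fun d => ⟨fun h => ?_, fun h => ?_⟩ <;> linarith

end Finite

end MultiHypergraph

theorem theorem1 {V E : Type*} [Finite V] [Finite E] (H : MultiHypergraph V E)
    (hH : H.Connected) (o₁ o₂ : LinearOrder E) :
    H.interiorPolynomial o₁ = H.interiorPolynomial o₂ ∧
      H.exteriorPolynomial o₁ = H.exteriorPolynomial o₂ := by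
  classical
  have := Fintype.ofFinite E
  constructor
  · rw [H.interiorPolynomial_eq, H.interiorPolynomial_eq]
    refine sum_X_pow_card_passiveSet_eq o₁ o₂ (H.upExchange_intHypertrees hH) fun p hp q hq => ?_
    obtain ⟨f, hf, rfl⟩ := MultiHypergraph.mem_intHypertrees.1 hp
    obtain ⟨g, hg, rfl⟩ := MultiHypergraph.mem_intHypertrees.1 hq
    beta_reduce
    exact_mod_cast H.sum_eq_of_isHypertree hH hf hg
  · rw [H.exteriorPolynomial_eq, H.exteriorPolynomial_eq]
    refine sum_X_pow_card_passiveSet_eq o₁ o₂ (H.upExchange_negHypertrees hH) fun p hp q hq => ?_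
    obtain ⟨f, hf, rfl⟩ := MultiHypergraph.mem_negHypertrees.1 hp
    obtain ⟨g, hg, rfl⟩ := MultiHypergraph.mem_negHypertrees.1 hq
    rw [Finset.sum_neg_distrib, Finset.sum_neg_distrib, neg_inj]
    exact_mod_cast H.sum_eq_of_isHypertree hH hf hg
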